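/- Fix integers $n\ge 2$ and $1\le k<N=\binom{n+1}{2}$, a nonempty set $L\subseteq(0,\infty)$ of admissible edge lengths, and a set $R\subseteq(0,\infty)$ of admissible radii that is comeager near $0$, i.e. for some $\varepsilon>0$ the set $R\cap(0,\varepsilon)$ is comeager in $(0,\varepsilon)$. Let $C$ be a nonempty set of colors. Say that a coloring $f\colon\mathbb R^n\to C$ satisfies $\mathcal Q^*$ if 1. $f$ is somewhere comeager: there are a color $c\in C$ and a nonempty open set $U\subseteq\mathbb R^n$ such that $f^{-1}(c)\cap U$ is comeager in $U$; and 2. for every color $c\in C$, every $p\in\mathbb R^n$ and every $r\in R$: if the set of points of color $c$ on the sphere $S_r(p)$ of radius $r$ centered at $p$ contains the $n+1$ (affinely independent) vertices of an $n$-simplex at least $k$ of whose $N$ edges have length in $L$, then $f(p)=c$. If $C$ is infinite (for example $C=\mathbb N$), then the following are equivalent: (i) every coloring $f\colon\mathbb R^n\to C$ satisfying $\mathcal Q^*$ is monochromatic (constant); (ii) $\inf(L)=0$. Moreover, the implication (ii) $\Rightarrow$ (i) holds for every nonempty set $C$ of colors, finite or infinite. -/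

import Mathlib

/-- A coloring is monochromatic if it is constant. -/
def Monochromatic {X C : Type*} (f : X → C) : Prop :=
  ∀ x y : X, f x = f y

/-- `A` is comeager in `U`: the trace of `A` on the subspace `U` is comeager in the
induced topology of `U`. -/
def ComeagerIn {X : Type*} [TopologicalSpace X] (A U : Set X) : Prop :=
  (Subtype.val ⁻¹' A : Set U) ∈ residual U

/-- A coloring is somewhere comeager if some color class is comeager in some nonempty
open set. -/
def SomewhereComeager {X C : Type*} [TopologicalSpace X] (f : X → C) : Prop :=
  ∃ c : C, ∃ U : Set X, IsOpen U ∧ U.Nonempty ∧ ComeagerIn (f ⁻¹' {c}) U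

/-- A set of real numbers is comeager near `0` if it is comeager in `(0, ε)` for some
`ε > 0`. -/
def ComeagerNearZero (R : Set ℝ) : Prop :=
  ∃ ε : ℝ, 0 < ε ∧ ComeagerIn R (Set.Ioo 0 ε)

/-- The forcing condition for a property `P` of subsets of `X`, a set `M` of admissible centers
and a set `R` of admissible radii: whenever the part of color `c` of an admissible sphere has a
subset with property `P`, the center of the sphere has color `c`. -/
def ForcingCondition {X C : Type*} [MetricSpace X] (P : Set X → Prop) (M : Set X) (R : Set ℝ)
    (f : X → C) : Prop :=
  ∀ c : C, ∀ p ∈ M, ∀ r ∈ R,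
    (∃ Γ : Set X, Γ ⊆ f ⁻¹' {c} ∩ Metric.sphere p r ∧ P Γ) → f p = c

/-- The condition `Q*` for `P` and `R`: the coloring is somewhere comeager, the set `R` of
admissible radii is comeager near `0`, and the forcing condition holds with all points as
admissible centers. -/
structure QStar {X C : Type*} [MetricSpace X] (P : Set X → Prop) (R : Set ℝ)
    (f : X → C) : Prop where
  somewhereComeager : SomewhereComeager f
  comeagerNearZero : ComeagerNearZero R
  forcing : ForcingCondition P Set.univ R f

/-- The number of edges of a simplex (pairs of distinct vertices) whose length lies in `L`. -/
noncomputable def edgeCount {n m : ℕ} (σ : Affine.Simplex ℝ (EuclideanSpace ℝ (Fin n)) m)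
    (L : Set ℝ) : ℕ :=
  {e : Fin (m + 1) × Fin (m + 1) |
    e.1 < e.2 ∧ dist (σ.points e.1) (σ.points e.2) ∈ L}.ncard

/-- A subset of `ℝⁿ` has this property if it contains the vertices of an `n`-simplex with at
least `k` of its edge lengths in `L`. -/
def HasSimplexWithEdges (n k : ℕ) (L : Set ℝ) (A : Set (EuclideanSpace ℝ (Fin n))) : Prop :=
  ∃ σ : Affine.Simplex ℝ (EuclideanSpace ℝ (Fin n)) n,
    Set.range σ.points ⊆ A ∧ k ≤ edgeCount σ L

/-!
Suppose first that `inf L = d > 0` and that there are infinitely many colors. Cut `ℝⁿ` into cubes of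
diameter less than `d` and give them pairwise distinct colors. No color class contains an edge with
length in `L`, so the forcing condition is vacuous, while the coloring is not constant
(`exists_qStar_not_monochromatic`).

Suppose now that `inf L = 0` and that a color class `A` is comeager in an open set `U`. Let `p` be a
center with a point `u ∈ U` at distance `0 < |u - p| < ε`, and take a very small `l ∈ L`. For every
`r > l` the sphere of radius `r` around `0` contains a nondegenerate simplex with vertices `v i r`
all of whose edges but one have length `l`, namely a regular simplex with `n` vertices together with
the mirror image of one of its vertices in the span of the others (`exists_simplex_family`). A pair
of a radius `r` and an orthogonal map `ρ` moves it to the sphere of radius `r` around `p`, and some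
pair places it in a small neighborhood of `u`, hence inside `U`. Each map `(r, ρ) ↦ p + ρ (v i r)`
is continuous and open (`nhds_le_map_rotate`), and so is `(r, ρ) ↦ r`; comeager sets pull back to
comeager sets along such maps (`ComeagerIn.preimage`). Baire's theorem on the space of pairs
therefore yields an admissible radius for which all vertices lie in `A`
(`exists_sphere_hasSimplexWithEdges`). As `k` is less than the number of edges, `p` is forced into
`A`. Hence `A` contains the `ε`-neighborhood of every open set in which it is comeager, so its
interior is nonempty, open and closed, and `A` is the whole space
(`monochromatic_of_sInf_eq_zero`).
-/

open Filter Topology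

/-! ### Pulling back comeager sets along open maps -/

/-- A map with a local section at `φ z` that is continuous there and passes through `z`
is open at `z`. -/
theorem nhds_le_map_of_section {Z Y : Type*} [TopologicalSpace Z] [TopologicalSpace Y]
    {φ : Z → Y} {z : Z} (s : Y → Z) (hs : ContinuousAt s (φ z)) (hsz : s (φ z) = z)
    (hφ : ∀ᶠ y in 𝓝 (φ z), φ (s y) = y) : 𝓝 (φ z) ≤ map φ (𝓝 z) := by
  intro S hS
  have h : ∀ᶠ y in 𝓝 (φ z), s y ∈ φ ⁻¹' S := by
    have := hs.tendsto
    rw [hsz] at this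
    exact this hS
  filter_upwards [h, hφ] with y hy hy'
  rwa [Set.mem_preimage, hy'] at hy

/-- Comeagerness pulls back along maps that are continuous and open on an open set. -/
theorem ComeagerIn.preimage {Z Y : Type*} [TopologicalSpace Z] [TopologicalSpace Y]
    {φ : Z → Y} {W : Set Z} {A U : Set Y} (hA : ComeagerIn A U) (hW : IsOpen W)
    (hc : ContinuousOn φ W) (ho : ∀ z ∈ W, 𝓝 (φ z) ≤ map φ (𝓝 z))
    (hm : Set.MapsTo φ W U) : ComeagerIn (φ ⁻¹' A) W := by
  have hopen : IsOpenMap (hm.restrict φ W U) := by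
    rw [isOpenMap_iff_nhds_le]
    intro z S hS
    have h1 : Subtype.val '' (hm.restrict φ W U ⁻¹' S) ∈ 𝓝 (z : Z) :=
      hW.isOpenMap_subtype_val.image_mem_nhds hS
    have h2 : φ '' (Subtype.val '' (hm.restrict φ W U ⁻¹' S)) ∈ 𝓝 (φ z) :=
      ho z z.2 (image_mem_map h1)
    rw [nhds_subtype_eq_comap]
    refine ⟨_, h2, ?_⟩
    rintro y ⟨_, ⟨x, hx, rfl⟩, hxy⟩
    have : hm.restrict φ W U x = y := Subtype.ext hxy
    exact this ▸ hx
  exact tendsto_residual_of_isOpenMap (hc.mapsToRestrict hm) hopen hA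

/-- Countably many sets comeager in the same nonempty open subset of a Baire space have a
common point there. -/
theorem exists_mem_of_forall_comeagerIn {Z ι : Type*} [TopologicalSpace Z] [BaireSpace Z]
    [Countable ι] {W : Set Z} (hW : IsOpen W) (hne : W.Nonempty) {A : ι → Set Z}
    (hA : ∀ i, ComeagerIn (A i) W) : ∃ z ∈ W, ∀ i, z ∈ A i := by
  have := hW.baireSpace
  have := hne.to_subtype
  have h : (⋂ i, (Subtype.val ⁻¹' A i : Set W)) ∈ residual W := countable_iInter_mem.2 hA
  obtain ⟨z, hz⟩ := (dense_of_mem_residual h).nonempty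
  exact ⟨z, z.2, fun i => Set.mem_iInter.1 hz i⟩

/-! ### Rotating a vector of varying length -/

section Rotations

variable {E : Type*} [NormedAddCommGroup E] [InnerProductSpace ℝ E] [FiniteDimensional ℝ E]

/-- The reflection in the hyperplane orthogonal to `w`, as a point of the orthogonal group;
for `w = 0` it is the identity. -/
noncomputable def hyperplaneReflection (w : E) : unitary (E →L[ℝ] E) :=
  Unitary.linearIsometryEquiv.symm (ℝ ∙ w)ᗮ.reflection

theorem hyperplaneReflection_apply (w x : E) :
    (hyperplaneReflection w : E →L[ℝ] E) x = x - (2 * (inner ℝ w x / ‖w‖ ^ 2)) • w := by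
  change (ℝ ∙ w)ᗮ.reflection x = _
  rw [Submodule.reflection_orthogonal_apply, Submodule.reflection_singleton_apply]
  simp [mul_smul, two_smul]

theorem hyperplaneReflection_sub {v w : E} (h : ‖v‖ = ‖w‖) :
    (hyperplaneReflection (v - w) : E →L[ℝ] E) v = w :=
  Submodule.reflection_sub h

theorem continuousOn_hyperplaneReflection :
    ContinuousOn (hyperplaneReflection : E → unitary (E →L[ℝ] E)) {0}ᶜ := by
  rw [Topology.IsInducing.subtypeVal.continuousOn_iff, continuousOn_clm_apply]
  intro x
  simp only [Function.comp_def, hyperplaneReflection_apply]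
  have h : ∀ w ∈ ({0}ᶜ : Set E), ‖w‖ ^ 2 ≠ 0 := fun w hw => by simpa using hw
  fun_prop (disch := assumption)

/-- A product of two reflections that carries `a` to `b` when `‖a‖ = ‖b‖`. Unlike the single
reflection in the direction `a - b`, it tends to the identity as `b` tends to `a ≠ 0`. -/
noncomputable def twoReflections (a b : E) : unitary (E →L[ℝ] E) :=
  hyperplaneReflection (-a - b) * hyperplaneReflection a

theorem twoReflections_apply {a b : E} (h : ‖a‖ = ‖b‖) :
    (twoReflections a b : E →L[ℝ] E) a = b := by
  have h1 : (hyperplaneReflection a : E →L[ℝ] E) a = -a :=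
    Submodule.reflection_orthogonalComplement_singleton_eq_neg a
  change (hyperplaneReflection (-a - b) : E →L[ℝ] E) ((hyperplaneReflection a : E →L[ℝ] E) a) = b
  rw [h1]
  exact hyperplaneReflection_sub (by rwa [norm_neg])

theorem twoReflections_self (a : E) : twoReflections a a = 1 := by
  have h : hyperplaneReflection (-a - a) = hyperplaneReflection a := by
    rcases eq_or_ne a 0 with rfl | ha
    · simp
    ext x
    simp only [hyperplaneReflection_apply]
    have : -a - a = (-2 : ℝ) • a := by module
    rw [this, inner_smul_left, norm_smul, smul_smul]
    have : ‖a‖ ≠ 0 := by simpa using ha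
    congr 2
    simp
    field_simp
  rw [twoReflections, h]
  change Unitary.linearIsometryEquiv.symm _ * Unitary.linearIsometryEquiv.symm _ = _
  rw [← map_mul, Submodule.reflection_mul_reflection, map_one]

/-- If `v r` has norm `r` and depends continuously on `r`, then `(r, ρ) ↦ p + ρ (v r)` is an open
map on the product of the radii with the orthogonal group: near each value `y`, a preimage is
obtained by composing with the rotation that carries `ρ (v ‖y - p‖)` to `y - p`. -/
theorem nhds_le_map_rotate {v : ℝ → E} {t : ℝ} (ht : 0 ≤ t) (hv : ContinuousOn v (Set.Ioi t))
    (hnorm : ∀ r > t, ‖v r‖ = r) (p : E) (z : ℝ × unitary (E →L[ℝ] E)) (hz : t < z.1) :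
    𝓝 (p + (z.2 : E →L[ℝ] E) (v z.1)) ≤
      map (fun z : ℝ × unitary (E →L[ℝ] E) => p + (z.2 : E →L[ℝ] E) (v z.1)) (𝓝 z) := by
  obtain ⟨r, ρ⟩ := z
  simp only at hz
  set φ : ℝ × unitary (E →L[ℝ] E) → E := fun z => p + (z.2 : E →L[ℝ] E) (v z.1) with hφ
  have hr0 : 0 < r := ht.trans_lt hz
  have hy0 : ‖φ (r, ρ) - p‖ = r := by
    simp only [hφ, add_sub_cancel_left, Unitary.norm_map, hnorm r hz]
  have hne : (ρ : E →L[ℝ] E) (v r) ≠ 0 := by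
    rw [← norm_ne_zero_iff, Unitary.norm_map, hnorm r hz]; exact hr0.ne'
  let a : E → E := fun y => (ρ : E →L[ℝ] E) (v ‖y - p‖)
  have ha0 : a (φ (r, ρ)) = (ρ : E →L[ℝ] E) (v r) := by simp only [a, hy0]
  have hb0 : φ (r, ρ) - p = (ρ : E →L[ℝ] E) (v r) := by simp [hφ]
  have hcv : ContinuousAt v r := hv.continuousAt (Ioi_mem_nhds hz)
  have hca : ContinuousAt a (φ (r, ρ)) := by
    have h1 : ContinuousAt (fun y : E => ‖y - p‖) (φ (r, ρ)) := by fun_prop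
    have h2 : ContinuousAt v ((fun y : E => ‖y - p‖) (φ (r, ρ))) := by simpa only [hy0] using hcv
    exact (ρ : E →L[ℝ] E).continuous.continuousAt.comp
      (ContinuousAt.comp (f := fun y : E => ‖y - p‖) h2 h1)
  have hrefl : ∀ w : E, w ≠ 0 → ContinuousAt (hyperplaneReflection : E → _) w := fun w hw =>
    continuousOn_hyperplaneReflection.continuousAt (isOpen_compl_singleton.mem_nhds hw)
  refine nhds_le_map_of_section (fun y => (‖y - p‖, twoReflections (a y) (y - p) * ρ)) ?_ ?_ ?_
  · refine ContinuousAt.prodMk (by fun_prop) (ContinuousAt.mul (ContinuousAt.mul ?_ ?_)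
      continuousAt_const)
    · refine ContinuousAt.comp (f := fun y => -a y - (y - p)) (hrefl _ ?_) (by fun_prop)
      simp only [ha0, hb0]
      intro h
      apply hne
      have : (-2 : ℝ) • (ρ : E →L[ℝ] E) (v r) = 0 := by rw [← h]; module
      simpa using this
    · exact ContinuousAt.comp (f := a) (hrefl _ (ha0 ▸ hne)) hca
  · simp only [ha0, hb0, twoReflections_self, one_mul, Unitary.norm_map, hnorm r hz]
  · have h : ∀ᶠ y in 𝓝 (φ (r, ρ)), ‖y - p‖ ∈ Set.Ioi t := by
      have h1 : ContinuousAt (fun y : E => ‖y - p‖) (φ (r, ρ)) := by fun_prop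
      exact h1.preimage_mem_nhds (by simpa only [hy0] using Ioi_mem_nhds hz)
    filter_upwards [h] with y hy
    have h2 : ‖a y‖ = ‖y - p‖ := by rw [Unitary.norm_map, hnorm _ hy]
    change p + (twoReflections (a y) (y - p) : E →L[ℝ] E) (a y) = y
    rw [twoReflections_apply h2]
    abel

end Rotations

/-! ### Simplices on a sphere with all edges equal but one -/

section Configuration

/-- The vector `(1, …, 1)`. -/
noncomputable def allOnes (m : ℕ) : EuclideanSpace ℝ (Fin (m + 1)) := WithLp.toLp 2 fun _ => 1

/-- The vertices `a (1, …, 1) + b eᵢ` of a regular simplex with edge length `√2 |b|`. -/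
noncomputable def regularVertex {m : ℕ} (a b : ℝ) (i : Fin (m + 1)) :
    EuclideanSpace ℝ (Fin (m + 1)) :=
  a • allOnes m + b • EuclideanSpace.single i 1

/-- A normal vector of the hyperplane through `0` and all vertices `regularVertex a b i` except
the last one. -/
noncomputable def faceNormal (m : ℕ) (a b : ℝ) : EuclideanSpace ℝ (Fin (m + 1)) :=
  ((m + 1) * a + b) • EuclideanSpace.single (Fin.last m) 1 - a • allOnes m

/-- The bipyramid consisting of the regular simplex `regularVertex a b` and, as its last vertex,
the mirror image of the last vertex of that simplex in the hyperplane spanned by `0` and the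
other vertices. -/
noncomputable def bipyramid (m : ℕ) (a b : ℝ) : Fin (m + 2) → EuclideanSpace ℝ (Fin (m + 1)) :=
  Fin.snoc (regularVertex a b)
    ((hyperplaneReflection (faceNormal m a b) :
      EuclideanSpace ℝ (Fin (m + 1)) →L[ℝ] EuclideanSpace ℝ (Fin (m + 1)))
        (regularVertex a b (Fin.last m)))

variable {m : ℕ} {a b : ℝ}

theorem inner_allOnes_self : inner ℝ (allOnes m) (allOnes m) = (m + 1 : ℝ) := by
  rw [real_inner_self_eq_norm_sq, EuclideanSpace.norm_sq_eq]
  simp [allOnes]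

theorem inner_allOnes_single (i : Fin (m + 1)) :
    inner ℝ (allOnes m) (EuclideanSpace.single i 1) = (1 : ℝ) := by
  simp [allOnes, EuclideanSpace.inner_single_right]

theorem inner_single_allOnes (i : Fin (m + 1)) :
    inner ℝ (EuclideanSpace.single i 1) (allOnes m) = (1 : ℝ) := by
  simp [allOnes, EuclideanSpace.inner_single_left]

theorem inner_single_single (i j : Fin (m + 1)) :
    inner ℝ (EuclideanSpace.single i (1 : ℝ)) (EuclideanSpace.single j (1 : ℝ)) =
      if i = j then (1 : ℝ) else 0 := by
  simp [EuclideanSpace.inner_single_left]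

theorem inner_allOnes_regularVertex (i : Fin (m + 1)) :
    inner ℝ (allOnes m) (regularVertex a b i) = (m + 1) * a + b := by
  simp only [regularVertex, inner_add_right, inner_smul_right, inner_allOnes_self,
    inner_allOnes_single]
  ring

theorem inner_allOnes_faceNormal : inner ℝ (allOnes m) (faceNormal m a b) = b := by
  simp only [faceNormal, inner_sub_right, inner_smul_right, inner_allOnes_self,
    inner_allOnes_single]
  ring

theorem inner_faceNormal_regularVertex (i : Fin (m + 1)) :
    inner ℝ (faceNormal m a b) (regularVertex a b i) =
      if i = Fin.last m then ((m + 1) * a + b) * b else 0 := by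
  rw [faceNormal, inner_sub_left, real_inner_smul_left, real_inner_smul_left,
    inner_allOnes_regularVertex]
  simp only [regularVertex, inner_add_right, inner_smul_right, inner_single_allOnes,
    inner_single_single, eq_comm (a := Fin.last m)]
  split_ifs <;> ring

theorem norm_regularVertex_sq (i : Fin (m + 1)) :
    ‖regularVertex a b i‖ ^ 2 = (m + 1) * a ^ 2 + 2 * a * b + b ^ 2 := by
  rw [← real_inner_self_eq_norm_sq]
  nth_rw 1 [regularVertex]
  rw [inner_add_left, real_inner_smul_left, real_inner_smul_left, inner_allOnes_regularVertex]
  simp only [regularVertex, inner_add_right, inner_smul_right, inner_single_allOnes,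
    inner_single_single, if_true]
  ring

theorem dist_regularVertex {i j : Fin (m + 1)} (h : i ≠ j) :
    dist (regularVertex a b i) (regularVertex a b j) = √2 * |b| := by
  have h1 : regularVertex a b i - regularVertex a b j =
      b • (EuclideanSpace.single i 1 - EuclideanSpace.single j 1) := by
    simp only [regularVertex]; module
  have h2 : ‖(EuclideanSpace.single i 1 - EuclideanSpace.single j 1 :
      EuclideanSpace ℝ (Fin (m + 1)))‖ = √2 := by
    rw [norm_eq_sqrt_real_inner]
    simp only [inner_sub_left, inner_sub_right, inner_single_single, if_true, h, h.symm, if_false]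
    norm_num
  rw [dist_eq_norm, h1, norm_smul, h2, Real.norm_eq_abs, mul_comm]

theorem bipyramid_castSucc (i : Fin (m + 1)) :
    bipyramid m a b i.castSucc = regularVertex a b i := by
  simp [bipyramid]

theorem bipyramid_last : bipyramid m a b (Fin.last (m + 1)) =
    (hyperplaneReflection (faceNormal m a b) :
      EuclideanSpace ℝ (Fin (m + 1)) →L[ℝ] EuclideanSpace ℝ (Fin (m + 1)))
        (regularVertex a b (Fin.last m)) := by
  simp [bipyramid]

theorem norm_bipyramid_sq (i : Fin (m + 2)) :
    ‖bipyramid m a b i‖ ^ 2 = (m + 1) * a ^ 2 + 2 * a * b + b ^ 2 := by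
  induction i using Fin.lastCases with
  | last => rw [bipyramid_last, Unitary.norm_map, norm_regularVertex_sq]
  | cast i => rw [bipyramid_castSucc, norm_regularVertex_sq]

/-- All edges of the bipyramid have length `√2 |b|`, except possibly the one that joins the two
mirror images. -/
theorem dist_bipyramid {i j : Fin (m + 2)} (hij : i < j)
    (h : ¬(i = (Fin.last m).castSucc ∧ j = Fin.last (m + 1))) :
    dist (bipyramid m a b i) (bipyramid m a b j) = √2 * |b| := by
  induction i using Fin.lastCases with
  | last => exact absurd hij (Fin.le_last j).not_gt
  | cast i =>
    induction j using Fin.lastCases with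
    | cast j =>
      rw [bipyramid_castSucc, bipyramid_castSucc]
      exact dist_regularVertex (by rintro rfl; exact lt_irrefl _ hij)
    | last =>
      have hi : i ≠ Fin.last m := by rintro rfl; exact h ⟨rfl, rfl⟩
      have hfix : (hyperplaneReflection (faceNormal m a b) :
          EuclideanSpace ℝ (Fin (m + 1)) →L[ℝ] EuclideanSpace ℝ (Fin (m + 1)))
            (regularVertex a b i) = regularVertex a b i := by
        rw [hyperplaneReflection_apply, inner_faceNormal_regularVertex, if_neg hi]
        simp
      rw [bipyramid_castSucc, bipyramid_last, ← hfix, dist_eq_norm, ← map_sub, Unitary.norm_map,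
        ← dist_eq_norm, dist_regularVertex hi]

theorem faceNormal_ne_zero (hb : b ≠ 0) : faceNormal m a b ≠ 0 := by
  intro h
  apply hb
  have := inner_allOnes_faceNormal (m := m) (a := a) (b := b)
  rwa [h, inner_zero_right, eq_comm] at this

/-- The vertices of the regular simplex lie in the hyperplane of vectors with coordinate sum
`(m + 1) a + b`, while the last vertex of the bipyramid does not. -/
theorem affineIndependent_bipyramid (hb : b ≠ 0) (hs : (m + 1) * a + b ≠ 0) :
    AffineIndependent ℝ (bipyramid m a b) := by
  rw [affineIndependent_iff_of_fintype]
  intro w hw hsum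
  rw [Finset.weightedVSub_eq_linear_combination (s := Finset.univ) hw, Fin.sum_univ_castSucc] at hsum
  rw [Fin.sum_univ_castSucc] at hw
  simp only [bipyramid_castSucc, bipyramid_last, hyperplaneReflection_apply] at hsum
  have hN : ‖faceNormal m a b‖ ≠ 0 := by simpa using faceNormal_ne_zero hb
  have hlast : w (Fin.last (m + 1)) = 0 := by
    have h := congrArg (inner ℝ (allOnes m)) hsum
    simp only [inner_add_right, inner_sum, inner_smul_right, inner_sub_right,
      inner_allOnes_regularVertex, inner_allOnes_faceNormal, inner_zero_right,
      inner_faceNormal_regularVertex, if_true, ← Finset.sum_mul] at h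
    have h' : w (Fin.last (m + 1)) *
        (2 * (((m + 1) * a + b) * b / ‖faceNormal m a b‖ ^ 2) * b) = 0 := by
      linear_combination ((m + 1) * a + b) * hw - h
    refine (mul_eq_zero.1 h').resolve_right ?_
    positivity
  intro i
  induction i using Fin.lastCases with
  | last => exact hlast
  | cast i =>
    rw [hlast, add_zero] at hw
    simp only [hlast, zero_smul, add_zero, regularVertex, smul_add, Finset.sum_add_distrib,
      ← Finset.sum_smul, hw, zero_add] at hsum
    have h := congrArg (fun x : EuclideanSpace ℝ (Fin (m + 1)) => x i) hsum
    simpa [hb, Finset.sum_apply, Pi.single_apply] using h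

/-- The parameter `a ≥ 0` for which the bipyramid with parameters `a` and `b` lies on the sphere
of radius `r` around `0`, i.e. a solution of `(m + 1) a² + 2 a b + b² = r²`. -/
noncomputable def bipyramidParameter (m : ℕ) (b r : ℝ) : ℝ :=
  (-b + √(b ^ 2 + (m + 1) * (r ^ 2 - b ^ 2))) / (m + 1)

theorem bipyramidParameter_sum (m : ℕ) (b r : ℝ) :
    (m + 1) * bipyramidParameter m b r + b = √(b ^ 2 + (m + 1) * (r ^ 2 - b ^ 2)) := by
  have : (m + 1 : ℝ) ≠ 0 := by positivity
  rw [bipyramidParameter, mul_div_cancel₀ _ this]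
  ring

theorem norm_bipyramid {r : ℝ} (hb : 0 < b) (hr : b < r) (i : Fin (m + 2)) :
    ‖bipyramid m (bipyramidParameter m b r) b i‖ = r := by
  have hd : 0 ≤ b ^ 2 + (m + 1) * (r ^ 2 - b ^ 2) := by
    have : 0 ≤ r ^ 2 - b ^ 2 := by nlinarith
    positivity
  have h1 := Real.sq_sqrt hd
  rw [← bipyramidParameter_sum] at h1
  rw [← sq_eq_sq₀ (norm_nonneg _) (hb.trans hr).le, norm_bipyramid_sq]
  have : (m + 1 : ℝ) ≠ 0 := by positivity
  apply mul_left_cancel₀ this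
  linear_combination h1

theorem continuous_bipyramid (hb : b ≠ 0) (i : Fin (m + 2)) :
    Continuous fun r => bipyramid m (bipyramidParameter m b r) b i := by
  have hp : Continuous (bipyramidParameter m b) := by unfold bipyramidParameter; fun_prop
  have hv : ∀ j, Continuous fun r => regularVertex (m := m) (bipyramidParameter m b r) b j := by
    intro j; unfold regularVertex; fun_prop
  induction i using Fin.lastCases with
  | cast i => simpa only [bipyramid_castSucc] using hv i
  | last =>
    have hn : Continuous fun r => faceNormal m (bipyramidParameter m b r) b := by
      unfold faceNormal; fun_prop
    have hne : ∀ r, ‖faceNormal m (bipyramidParameter m b r) b‖ ^ 2 ≠ 0 := fun r => by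
      simpa using faceNormal_ne_zero hb
    simp only [bipyramid_last, hyperplaneReflection_apply]
    have := hv (Fin.last m)
    fun_prop (disch := assumption)

/-- For `r > l > 0` the sphere of radius `r` in `ℝ^(m+1)` contains the vertices of a nondegenerate
simplex all of whose edges but one have length `l`, and the simplex can be chosen to depend
continuously on `r`. -/
theorem exists_simplex_family (m : ℕ) {l : ℝ} (hl : 0 < l) :
    ∃ v : Fin (m + 2) → ℝ → EuclideanSpace ℝ (Fin (m + 1)),
      (∀ i, Continuous (v i)) ∧ (∀ r > l, ∀ i, ‖v i r‖ = r) ∧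
      (∀ r > l, AffineIndependent ℝ fun i => v i r) ∧
      ∀ r, ∀ i j, i < j → ¬(i = (Fin.last m).castSucc ∧ j = Fin.last (m + 1)) →
        dist (v i r) (v j r) = l := by
  have h2 : (1 : ℝ) < √2 := Real.lt_sqrt_of_sq_lt (by norm_num)
  have hb : 0 < l / √2 := by positivity
  have hbl : l / √2 < l := div_lt_self hl h2
  refine ⟨fun i r => bipyramid m (bipyramidParameter m (l / √2) r) (l / √2) i,
    continuous_bipyramid hb.ne', fun r hr i => norm_bipyramid hb (hbl.trans hr) i,
    fun r hr => affineIndependent_bipyramid hb.ne' ?_, fun r i j hij h => ?_⟩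
  · rw [bipyramidParameter_sum]
    have : 0 < r ^ 2 - (l / √2) ^ 2 := by
      have := hbl.trans hr
      nlinarith
    positivity
  · rw [dist_bipyramid hij h, abs_of_pos hb]
    field_simp

end Configuration

/-! ### Arbitrarily small edge lengths -/

section SmallEdges

/-- A simplex all of whose edges, except possibly the one joining its last two vertices, have the
admissible length `l` has at least `N - 1` admissible edges. -/
theorem choose_le_edgeCount {m : ℕ}
    (σ : Affine.Simplex ℝ (EuclideanSpace ℝ (Fin (m + 1))) (m + 1)) {L : Set ℝ} {l : ℝ}
    (hl : l ∈ L) (h : ∀ i j, i < j → ¬(i = (Fin.last m).castSucc ∧ j = Fin.last (m + 1)) →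
      dist (σ.points i) (σ.points j) = l) :
    (m + 2).choose 2 - 1 ≤ edgeCount σ L := by
  classical
  set s : Finset (Fin (m + 2) × Fin (m + 2)) :=
    (Finset.univ ×ˢ Finset.univ).filter fun e => e.1 < e.2 with hs
  have hcard : s.card = (m + 2).choose 2 := by
    rw [hs, Finset.card_product_filter_lt, Finset.card_univ, Fintype.card_fin]
  rw [edgeCount, ← hcard]
  refine Finset.pred_card_le_card_erase.trans
    (b := (s.erase ((Fin.last m).castSucc, Fin.last (m + 1))).card) ?_
  rw [← Set.ncard_coe_finset]
  refine Set.ncard_le_ncard ?_ (Set.toFinite _)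
  rintro ⟨i, j⟩ hij
  simp only [hs, Finset.coe_erase, Set.mem_sdiff, Set.mem_singleton_iff, Prod.mk.injEq,
    Finset.mem_coe, Finset.mem_filter] at hij
  refine ⟨hij.1.2, ?_⟩
  simp only
  rw [h i j hij.1.2 hij.2]
  exact hl

theorem baireSpace_real_prod_unitary (E : Type*) [NormedAddCommGroup E] [InnerProductSpace ℝ E]
    [FiniteDimensional ℝ E] : BaireSpace (ℝ × unitary (E →L[ℝ] E)) := by
  have : CompleteSpace (unitary (E →L[ℝ] E)) := isClosed_unitary.completeSpace_coe
  infer_instance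

/-- If `A` is comeager in an open set `U` and `R` is comeager in `(0, ε)`, then every point
`p` at distance less than `ε` from a point `u ≠ p` of `U` is the center of an admissible sphere
that carries the vertices of a suitable simplex in `A`: Baire's theorem is applied to the space of
pairs of a radius and an orthogonal map, which place a small simplex near `u`. -/
theorem exists_sphere_hasSimplexWithEdges {m k : ℕ} (hm : 1 ≤ m) (hk : k < (m + 2).choose 2)
    {L R : Set ℝ} (hL : L.Nonempty) (hLpos : L ⊆ Set.Ioi 0) (hinf : sInf L = 0) {ε : ℝ}
    (hR : ComeagerIn R (Set.Ioo 0 ε)) {A U : Set (EuclideanSpace ℝ (Fin (m + 1)))}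
    (hU : IsOpen U) (hA : ComeagerIn A U) {p u : EuclideanSpace ℝ (Fin (m + 1))} (hu : u ∈ U)
    (hpu : u ≠ p) (hd : dist u p < ε) :
    ∃ r ∈ R, ∃ Γ ⊆ A ∩ Metric.sphere p r, HasSimplexWithEdges (m + 1) k L Γ := by
  obtain ⟨η, hη, hball⟩ := Metric.isOpen_iff.1 hU u hu
  obtain ⟨l, hlL, hl⟩ : ∃ l ∈ L, l < min η (dist u p) :=
    exists_lt_of_csInf_lt hL (hinf ▸ lt_min hη (dist_pos.2 hpu))
  have hl0 : 0 < l := hLpos hlL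
  have hlp : l < dist u p := hl.trans_le (min_le_right _ _)
  obtain ⟨v, hvc, hvn, hvi, hvd⟩ := exists_simplex_family m hl0
  let φ : Fin (m + 2) →
      ℝ × unitary (EuclideanSpace ℝ (Fin (m + 1)) →L[ℝ] EuclideanSpace ℝ (Fin (m + 1))) →
        EuclideanSpace ℝ (Fin (m + 1)) := fun i z => p + z.2.1 (v i z.1)
  have hφ : ∀ i, Continuous (φ i) := fun i => continuous_const.add
    ((continuous_subtype_val.comp continuous_snd).clm_apply ((hvc i).comp continuous_fst))
  let W := Prod.fst ⁻¹' Set.Ioo l ε ∩ ⋂ i, φ i ⁻¹' U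
  have hW : IsOpen W := (isOpen_Ioo.preimage continuous_fst).inter
    (isOpen_iInter_of_finite fun i => hU.preimage (hφ i))
  have hdist : ∀ z i j, dist (φ i z) (φ j z) = dist (v i z.1) (v j z.1) := fun z i j => by
    simp only [φ]
    rw [dist_add_left, dist_eq_norm, ← map_sub, Unitary.norm_map, ← dist_eq_norm]
  have hne : W.Nonempty := by
    have hn : ‖v 0 (dist u p)‖ = ‖u - p‖ := by rw [hvn _ hlp, dist_eq_norm]
    have h0 : φ 0 (dist u p, hyperplaneReflection (v 0 (dist u p) - (u - p))) = u := by
      simp only [φ, hyperplaneReflection_sub hn]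
      abel
    refine ⟨(dist u p, hyperplaneReflection (v 0 (dist u p) - (u - p))), ⟨hlp, hd⟩,
      Set.mem_iInter.2 fun i => hball ?_⟩
    -- All vertices are joined to the vertex `0`, placed at `u`, by edges of length `l`.
    rcases eq_or_ne i 0 with rfl | hi
    · rw [h0]; exact Metric.mem_ball_self hη
    · have hi0 := hdist (dist u p, hyperplaneReflection (v 0 (dist u p) - (u - p))) 0 i
      rw [h0, dist_comm u, hvd _ 0 i (Fin.pos_of_ne_zero hi)] at hi0
      · exact hi0.trans_lt (hl.trans_le (min_le_left _ _))
      · rintro ⟨h, -⟩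
        have := congrArg Fin.val h
        simp at this
        omega
  let B := fun o : Option (Fin (m + 2)) =>
    o.elim (Prod.fst ⁻¹' R) fun i => φ i ⁻¹' A
  have hB : ∀ o, ComeagerIn (B o) W := by
    rintro (_ | i)
    · exact hR.preimage hW continuous_fst.continuousOn (fun z _ => isOpenMap_fst.nhds_le z)
        fun z hz => ⟨hl0.trans hz.1.1, hz.1.2⟩
    · exact hA.preimage hW (hφ i).continuousOn
        (fun z hz => nhds_le_map_rotate hl0.le (hvc i).continuousOn (fun r hr => hvn r hr i) p z
          hz.1.1) fun z hz => Set.mem_iInter.1 hz.2 i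
  have := baireSpace_real_prod_unitary (EuclideanSpace ℝ (Fin (m + 1)))
  obtain ⟨⟨r, ρ⟩, hz, hzB⟩ := exists_mem_of_forall_comeagerIn hW hne hB
  have hlr : l < r := hz.1.1
  have hind : AffineIndependent ℝ fun i => φ i (r, ρ) := by
    let e : EuclideanSpace ℝ (Fin (m + 1)) →ᵃ[ℝ] EuclideanSpace ℝ (Fin (m + 1)) :=
      ρ.1.toLinearMap.toAffineMap + AffineMap.const ℝ _ p
    have he : ∀ x, e x = p + ρ.1 x := fun x => add_comm _ _
    have hinj : Function.Injective e := by
      intro x y hxy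
      rw [he, he, add_right_inj] at hxy
      rw [← sub_eq_zero, ← norm_eq_zero, ← Unitary.norm_map ρ, map_sub, hxy, sub_self, norm_zero]
    have := (hvi r hlr).map' e hinj
    simpa only [Function.comp_def, he] using this
  refine ⟨r, hzB none, Set.range fun i => φ i (r, ρ), ?_, ⟨_, hind⟩, subset_rfl, ?_⟩
  · rintro _ ⟨i, rfl⟩
    refine ⟨hzB (some i), ?_⟩
    simp only [φ]
    rw [mem_sphere_iff_norm, add_sub_cancel_left, Unitary.norm_map, hvn r hlr]
  · have := choose_le_edgeCount ⟨_, hind⟩ hlL fun i j hij h =>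
      (hdist (r, ρ) i j).trans (hvd r i j hij h)
    omega

/-- If `inf L = 0`, a color class that is comeager in some open set is everything: it contains the
open `ε`-neighborhood of that open set, so its interior is nonempty, open and closed. -/
theorem monochromatic_of_sInf_eq_zero {m k : ℕ} (hm : 1 ≤ m) (hk : k < (m + 2).choose 2)
    {L R : Set ℝ} (hL : L.Nonempty) (hLpos : L ⊆ Set.Ioi 0) (hinf : sInf L = 0) {C : Type*}
    {f : EuclideanSpace ℝ (Fin (m + 1)) → C} (hf : QStar (HasSimplexWithEdges (m + 1) k L) R f) :
    Monochromatic f := by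
  obtain ⟨⟨c, U, hU, hUne, hA⟩, ⟨ε, hε, hR⟩, hforce⟩ := hf
  have key : ∀ V : Set (EuclideanSpace ℝ (Fin (m + 1))), IsOpen V → ComeagerIn (f ⁻¹' {c}) V →
      ∀ u ∈ V, Metric.ball u ε ⊆ f ⁻¹' {c} := by
    intro V hV hAV u hu p hp
    have hcol : ∀ w ∈ V, w ≠ p → dist w p < ε → f p = c := fun w hw hwp hd => by
      obtain ⟨r, hr, Γ, hΓ⟩ :=
        exists_sphere_hasSimplexWithEdges hm hk hL hLpos hinf hR hV hAV hw hwp hd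
      exact hforce c p trivial r hr ⟨Γ, hΓ⟩
    -- A point of `V` near `u` and distinct from `p`: this is needed when `p = u`.
    have := Module.punctured_nhds_neBot ℝ (EuclideanSpace ℝ (Fin (m + 1))) p
    rcases eq_or_ne u p with rfl | hne
    · have h : ∀ᶠ w in 𝓝[≠] u, w ∈ V ∩ Metric.ball u ε ∧ w ∈ ({u}ᶜ : Set _) :=
        (eventually_nhdsWithin_of_eventually_nhds
          ((hV.inter Metric.isOpen_ball).mem_nhds ⟨hu, hp⟩)).and self_mem_nhdsWithin
      obtain ⟨w, hw, hwu⟩ := h.exists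
      exact hcol w hw.1 hwu hw.2
    · exact hcol u hu hne (by rwa [dist_comm])
  have hint : ComeagerIn (f ⁻¹' {c}) (interior (f ⁻¹' {c})) :=
    mem_of_superset univ_mem fun x _ => interior_subset (s := f ⁻¹' {c}) x.2
  have hclopen : IsClopen (interior (f ⁻¹' {c})) := by
    refine ⟨isClosed_of_closure_subset fun p hp => ?_, isOpen_interior⟩
    obtain ⟨w, hw, hpw⟩ := Metric.mem_closure_iff.1 hp ε hε
    exact interior_maximal (key _ isOpen_interior hint w hw) Metric.isOpen_ball hpw
  obtain ⟨u, hu⟩ := hUne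
  have huniv := hclopen.eq_univ
    ⟨u, interior_maximal (key U hU hA u hu) Metric.isOpen_ball (Metric.mem_ball_self hε)⟩
  have hall : ∀ x, f x = c := fun x =>
    interior_subset (s := f ⁻¹' {c}) (huniv.symm ▸ Set.mem_univ x)
  exact fun x y => (hall x).trans (hall y).symm

end SmallEdges

/-! ### Edge lengths bounded away from zero -/

section LargeEdges

/-- If all lengths in `L` are at least `d > 0`, then cutting space into cubes of diameter less
than `d` and giving them distinct colors yields a nonconstant coloring in which no color class
contains an admissible edge, so that nothing is forced. -/
theorem exists_qStar_not_monochromatic {n k : ℕ} (hn : 2 ≤ n) (hk : 1 ≤ k) {L R : Set ℝ}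
    (hR : ComeagerNearZero R) {d : ℝ} (hd : 0 < d) (hLd : ∀ l ∈ L, d ≤ l) (C : Type*)
    [Infinite C] : ∃ f : EuclideanSpace ℝ (Fin n) → C,
      QStar (HasSimplexWithEdges n k L) R f ∧ ¬Monochromatic f := by
  obtain ⟨h, hh⟩ := exists_injective_nat (Fin n → ℤ)
  let g : (Fin n → ℤ) → C := Infinite.natEmbedding C ∘ h
  have hg : Function.Injective g := (Infinite.natEmbedding C).injective.comp hh
  have hn' : (2 : ℝ) ≤ n := by exact_mod_cast hn
  set s : ℝ := d / n with hs
  have hs0 : 0 < s := by positivity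
  let f : EuclideanSpace ℝ (Fin n) → C := fun x => g fun i => ⌊x i / s⌋
  have hclose : ∀ x y, f x = f y → dist x y < d := by
    intro x y hxy
    rw [EuclideanSpace.dist_eq, Real.sqrt_lt' hd]
    have hi : ∀ i, dist (x i) (y i) ^ 2 ≤ s ^ 2 := fun i => by
      have h1 := Int.abs_sub_lt_one_of_floor_eq_floor (congrFun (hg hxy) i)
      rw [← sub_div, abs_div, abs_of_pos hs0, div_lt_one hs0] at h1
      rw [Real.dist_eq]
      exact pow_le_pow_left₀ (abs_nonneg _) h1.le 2
    calc ∑ i, dist (x i) (y i) ^ 2 ≤ ∑ _i : Fin n, s ^ 2 := Finset.sum_le_sum fun i _ => hi i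
      _ = d ^ 2 / n := by simp [hs]; field_simp
      _ < d ^ 2 := div_lt_self (by positivity) (by linarith)
  refine ⟨f, ⟨?_, hR, ?_⟩, fun hmono => ?_⟩
  · refine ⟨g 0, ⋂ i, (fun x => x i) ⁻¹' Set.Ioo 0 s, ?_, ?_, ?_⟩
    · exact isOpen_iInter_of_finite fun i => isOpen_Ioo.preimage (by fun_prop)
    · exact ⟨WithLp.toLp 2 fun _ => s / 2,
        Set.mem_iInter.2 fun i => ⟨half_pos hs0, half_lt_self hs0⟩⟩
    · refine mem_of_superset univ_mem fun x _ => congrArg g (funext fun i => ?_)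
      have hx := Set.mem_iInter.1 x.2 i
      exact Int.floor_eq_zero_iff.2 ⟨(div_pos hx.1 hs0).le, (div_lt_one hs0).2 hx.2⟩
  · rintro c p - r - ⟨Γ, hΓ, σ, hσ, hcount⟩
    exfalso
    obtain ⟨e, -, he⟩ := Set.nonempty_of_ncard_ne_zero
      (Nat.one_le_iff_ne_zero.1 (hk.trans hcount))
    have h1 : ∀ i, f (σ.points i) = c := fun i => (hΓ (hσ ⟨i, rfl⟩)).1
    exact (hclose _ _ ((h1 e.1).trans (h1 e.2).symm)).not_ge (hLd _ he)
  · have hlt : 0 < n := by omega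
    have h1 := congrFun (hg (hmono 0 (WithLp.toLp 2 fun _ => s))) ⟨0, hlt⟩
    simp [div_self hs0.ne'] at h1

end LargeEdges

/-! ### The equivalence -/

theorem theorem5 (n : ℕ) (hn : 2 ≤ n) (k : ℕ) (hk : 1 ≤ k) (hkN : k < (n + 1).choose 2)
    (L : Set ℝ) (hL : L.Nonempty) (hLpos : L ⊆ Set.Ioi 0)
    (R : Set ℝ) (hRpos : R ⊆ Set.Ioi 0) (hR : ComeagerNearZero R)
    (C : Type*) [Nonempty C] :
    (Infinite C →
      ((∀ f : EuclideanSpace ℝ (Fin n) → C,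
          QStar (HasSimplexWithEdges n k L) R f → Monochromatic f) ↔ sInf L = 0)) ∧
    (sInf L = 0 →
      ∀ f : EuclideanSpace ℝ (Fin n) → C,
        QStar (HasSimplexWithEdges n k L) R f → Monochromatic f) := by
  have h : sInf L = 0 → ∀ f : EuclideanSpace ℝ (Fin n) → C,
      QStar (HasSimplexWithEdges n k L) R f → Monochromatic f := by
    intro hinf f hf
    obtain ⟨m, rfl⟩ : ∃ m, n = m + 1 := ⟨n - 1, by omega⟩
    exact monochromatic_of_sInf_eq_zero (by omega) hkN hL hLpos hinf hf
  refine ⟨fun _ => ⟨fun hall => ?_, h⟩, h⟩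
  by_contra hne
  have hpos : 0 < sInf L := (Real.sInf_nonneg fun l hl => (hLpos hl).le).lt_of_ne' hne
  have hbdd : BddBelow L := ⟨0, fun l hl => (hLpos hl).le⟩
  obtain ⟨f, hf, hmono⟩ :=
    exists_qStar_not_monochromatic hn hk hR hpos (fun l hl => csInf_le hbdd hl) C
  exact hmono (hall f hf)
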